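/- Let $(\mathcal X,\mathcal A,C,D,P)$ be a finite MDP with cost $C$, constraint cost $D$, target state $x_{\mathrm{Tar}}$ and initial state $x^0\neq x_{\mathrm{Tar}}$; let $\gamma,\alpha\in(0,1)$, $\lambda\ge 0$, $\nu\in\mathbb R$. In the augmented MDP the states are pairs $(x,s)\in\mathcal X\times\mathbb R$, the initial state is $(x^0,\nu)$, the cost is $\bar C_\lambda(x,s,a)=C(x,a)$ for $x\ne x_{\mathrm{Tar}}$ and $\bar C_\lambda(x_{\mathrm{Tar}},s,a)=\lambda(-s)^+/(1-\alpha)$, and the transition law is $\bar P(x',s'|x,s,a)=P(x'|x,a)\mathbf 1\{s'=(s-D(x,a))/\gamma\}$ for $x\neq x_{\mathrm{Tar}}$ and $\bar P(x',s'|x_{\mathrm{Tar}},s,a)=\mathbf 1\{x'=x_{\mathrm{Tar}},s'=0\}$. Let $\bar{\mathcal X}$ be the set of pairs reachable from $(x^0,\nu)$, and assume it is finite. Fix a stationary policy $\mu(a|x,s)$ on $\bar{\mathcal X}$ (for instance $\mu(\cdot|\cdot;\theta)$ with $\theta$ fixed), and let $d_\gamma(y)=(1-\gamma)\sum_{k\ge0}\gamma^k\,\mathbb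 P(y_k=y\mid y_0=(x^0,\nu);\mu)$ and $\pi_\gamma(y,a)=d_\gamma(y)\mu(a|y)$ be the $\gamma$-discounted occupation measures. Let $\phi:\bar{\mathcal X}\to\mathbb R^{\kappa}$ be a feature map, $\Phi$ the matrix with rows $\phi(y)^\top$, and assume that the columns of $\Phi$ are linearly independent as functions on $\{y: d_\gamma(y)>0\}$. Write $\|V\|_{d}^2=\sum_y d_\gamma(y)V(y)^2$, let $\Pi$ be the $\|\cdot\|_{d}$-orthogonal projection onto $\{\Phi v\}$, namely $\Pi=\Phi(\Phi^\top \mathrm{diag}(d_\gamma)\Phi)^{-1}\Phi^\top\mathrm{diag}(d_\gamma)$, and let $$B[V](y)=\sum_a\mu(a|y)\Big\{\bar C_\lambda(y,a)+\gamma\sum_{y'}\bar P(y'|y,a)V(y')\Big\},$$ $$A=\sum_{y,a}\pi_\gamma(y,a)\phi(y)\Big(\phi(y)-\gamma\sum_{y'}\bar P(y'|y,a)\phi(y')\Big)^{\!\top},\qquad b=\sum_{y,a}\pi_\gamma(y,a)\phi(y)\bar C_\lambda(y,a).$$ Let the step sizes $\zeta(k)\ge0$ satisfy $\sum_k\zeta(k)=\infty$,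 $\sum_k\zeta(k)^2<\infty$, and let $(y_k,a_k,y_k')$, $k\ge 0$, be independent samples with $(y_k,a_k)\sim\pi_\gamma$ and $y_k'\sim\bar P(\cdot|y_k,a_k)$. Then there is $v^*\in\mathbb R^\kappa$ such that: 1. $v^*$ is the unique solution of $Av=b$; 2. $v^*$ is the unique $v$ with $\Phi v=\Pi B[\Phi v]$ (projected Bellman fixed point); 3. $v^*$ is the unique minimizer of the projected Bellman residual $v\mapsto\|\Pi B[\Phi v]-\Phi v\|_{d}^2$; it is also the unique $u$ with $u\in\arg\min_v\|B[\Phi u]-\Phi v\|_{d}^2$; and, if the Bellman residual $\|B[\Phi v]-\Phi v\|_{d}^2$ vanishes for some $v$, then $v^*$ is the unique minimizer of that residual; 4. for every $v_0\in\mathbb R^\kappa$, the TD(0) critic iterates $v_{k+1}=v_k+\zeta(k)\,\delta_k\,\phi(y_k)$ with $\delta_k=\bar C_\lambda(y_k,a_k)+\gamma v_k^\top\phi(y_k')-v_k^\top\phi(y_k)$ converge to $v^*$ almost surely. -/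

import Mathlib

open MeasureTheory ProbabilityTheory Filter Topology
open scoped Matrix

/-- A finite Markov decision process with cost `C`, constraint cost `D`, transition
probabilities `P x a x' = P(x' | x, a)`, a target state and an initial state. -/
structure CMDP (X A : Type*) [Fintype X] [Fintype A] where
  C : X → A → ℝ
  D : X → A → ℝ
  P : X → A → X → ℝ
  P_nonneg : ∀ x a x', 0 ≤ P x a x'
  P_sum : ∀ x a, ∑ x', P x a x' = 1
  xTar : X
  x0 : X
  x0_ne : x0 ≠ xTar

namespace CMDP

variable {X A : Type*} [Fintype X] [Fintype A]

/-- The pairs `(x, s)` that the augmented MDP can reach from `(x0, ν)`: outside the target the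
second component moves from `s` to `(s - D x a) / γ`, at the target it is reset to `0`. -/
inductive AugReachable (M : CMDP X A) (γ ν : ℝ) : X × ℝ → Prop
  | init : AugReachable M γ ν (M.x0, ν)
  | step (x : X) (s : ℝ) (a : A) (x' : X) (h : AugReachable M γ ν (x, s)) (hx : x ≠ M.xTar)
      (hP : 0 < M.P x a x') : AugReachable M γ ν (x', (s - M.D x a) / γ)
  | target (s : ℝ) (h : AugReachable M γ ν (M.xTar, s)) : AugReachable M γ ν (M.xTar, 0)

/-- The state space of the augmented MDP with initial state `(x0, ν)`. -/
abbrev AugState (M : CMDP X A) (γ ν : ℝ) : Type _ := {y : X × ℝ // M.AugReachable γ ν y}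

/-- The initial augmented state `(x0, ν)`. -/
def augInit (M : CMDP X A) (γ ν : ℝ) : M.AugState γ ν := ⟨(M.x0, ν), AugReachable.init⟩

variable {M : CMDP X A} {γ ν : ℝ}

open Classical in
/-- The augmented cost: `lam * (-s)⁺ / (1 - α)` at the target, `C x a` elsewhere. -/
noncomputable def augCost (M : CMDP X A) {γ ν : ℝ} (α lam : ℝ) (y : M.AugState γ ν) (a : A) : ℝ :=
  if y.1.1 = M.xTar then lam * max (-y.1.2) 0 / (1 - α) else M.C y.1.1 a

open Classical in
/-- The augmented transition probability `augP M y a y'` of moving from `y` to `y'` under `a`. -/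
noncomputable def augP (M : CMDP X A) {γ ν : ℝ} (y : M.AugState γ ν) (a : A)
    (y' : M.AugState γ ν) : ℝ :=
  if y.1.1 = M.xTar then
    (if y'.1.1 = M.xTar ∧ y'.1.2 = 0 then 1 else 0)
  else
    M.P y.1.1 a y'.1.1 * (if y'.1.2 = (y.1.2 - M.D y.1.1 a) / γ then 1 else 0)

/-- A stationary stochastic policy on the augmented MDP; `prob y a` is `μ(a | y)`. -/
structure Policy (M : CMDP X A) (γ ν : ℝ) where
  prob : M.AugState γ ν → A → ℝ
  nonneg : ∀ y a, 0 ≤ prob y a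
  sum_eq_one : ∀ y, ∑ a, prob y a = 1

variable [Fintype (M.AugState γ ν)]

open Classical in
/-- The probability that the augmented chain, started at `(x0, ν)` and controlled by `μ`, is in
state `y` at time `k`. -/
noncomputable def stateProb (μ : Policy M γ ν) : ℕ → M.AugState γ ν → ℝ
  | 0, y => if y = M.augInit γ ν then 1 else 0
  | k + 1, y => ∑ z, ∑ a, stateProb μ k z * μ.prob z a * M.augP z a y

/-- The `γ`-discounted occupation measure of augmented states. -/
noncomputable def occ (μ : Policy M γ ν) (y : M.AugState γ ν) : ℝ :=
  (1 - γ) * ∑' k : ℕ, γ ^ k * stateProb μ k y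

/-- The `γ`-discounted occupation measure of pairs of an augmented state and an action. -/
noncomputable def occSA (μ : Policy M γ ν) (y : M.AugState γ ν) (a : A) : ℝ :=
  occ μ y * μ.prob y a

/-- The Bellman operator of the policy `μ` on the augmented MDP. -/
noncomputable def bellman (μ : Policy M γ ν) (α lam : ℝ) (V : M.AugState γ ν → ℝ)
    (y : M.AugState γ ν) : ℝ :=
  ∑ a, μ.prob y a * (M.augCost α lam y a + ∑ y', γ * M.augP y a y' * V y')

/-- The squared (semi)norm weighted by the occupation measure. -/
noncomputable def occNormSq (μ : Policy M γ ν) (V : M.AugState γ ν → ℝ) : ℝ :=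
  ∑ y, occ μ y * V y ^ 2

variable {κ : ℕ}

/-- The feature matrix; its row at `y` is the feature vector `φ y`. -/
def featMat (φ : M.AugState γ ν → Fin κ → ℝ) : Matrix (M.AugState γ ν) (Fin κ) ℝ :=
  Matrix.of φ

/-- The basis functions (columns of the feature matrix) are linearly independent as functions on
the set of augmented states that the occupation measure charges. -/
def IndependentBasis (μ : Policy M γ ν) (φ : M.AugState γ ν → Fin κ → ℝ) : Prop :=
  LinearIndependent ℝ (fun (i : Fin κ) (y : {y : M.AugState γ ν // 0 < occ μ y}) => φ y.1 i)

/-- The matrix `Φᵀ diag(occ) Φ`. -/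
noncomputable def gram (μ : Policy M γ ν) (φ : M.AugState γ ν → Fin κ → ℝ) :
    Matrix (Fin κ) (Fin κ) ℝ :=
  fun i j => ∑ y, occ μ y * φ y i * φ y j

/-- The orthogonal projection `Φ (Φᵀ diag(occ) Φ)⁻¹ Φᵀ diag(occ)` onto the column span of the
feature matrix, with respect to the norm weighted by the occupation measure. -/
noncomputable def proj (μ : Policy M γ ν) (φ : M.AugState γ ν → Fin κ → ℝ)
    (V : M.AugState γ ν → ℝ) : M.AugState γ ν → ℝ :=
  featMat φ *ᵥ ((gram μ φ)⁻¹ *ᵥ (fun i => ∑ y, occ μ y * φ y i * V y))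

/-- The matrix `A = ∑ π(y,a) φ(y) (φ(y) - γ ∑ P(y'|y,a) φ(y'))ᵀ`. -/
noncomputable def tdA (μ : Policy M γ ν) (φ : M.AugState γ ν → Fin κ → ℝ) :
    Matrix (Fin κ) (Fin κ) ℝ :=
  fun i j => ∑ y, ∑ a, occSA μ y a * (φ y i * (φ y j - γ * ∑ y', M.augP y a y' * φ y' j))

/-- The vector `b = ∑ π(y,a) φ(y) c(y,a)`, with `c` the augmented cost. -/
noncomputable def tdB (μ : Policy M γ ν) (φ : M.AugState γ ν → Fin κ → ℝ) (α lam : ℝ) :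
    Fin κ → ℝ :=
  fun i => ∑ y, ∑ a, occSA μ y a * (φ y i * M.augCost α lam y a)

/-- The temporal-difference error at weights `v` of a sample `(y, a, y')`. -/
noncomputable def tdError (φ : M.AugState γ ν → Fin κ → ℝ) (α lam : ℝ) (v : Fin κ → ℝ)
    (z : M.AugState γ ν × A × M.AugState γ ν) : ℝ :=
  M.augCost α lam z.1 z.2.1 + γ * (v ⬝ᵥ φ z.2.2) - v ⬝ᵥ φ z.1

/-- The critic iterates driven by the samples `z 0, z 1, …` with step sizes `ζ`. -/
noncomputable def critic (φ : M.AugState γ ν → Fin κ → ℝ) (α lam : ℝ) (ζ : ℕ → ℝ)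
    (v0 : Fin κ → ℝ) (z : ℕ → M.AugState γ ν × A × M.AugState γ ν) : ℕ → Fin κ → ℝ
  | 0 => v0
  | k + 1 => critic φ α lam ζ v0 z k
      + (ζ k * tdError φ α lam (critic φ α lam ζ v0 z k) (z k)) • φ (z k).1

/-- The samples `Z k = (y_k, a_k, y'_k)` are independent, `(y_k, a_k)` is distributed according to
the occupation measure, and `y'_k` is the augmented successor of `y_k` under the action `a_k`. -/
structure IsOccSampling (μ : Policy M γ ν) {Ω : Type*} [MeasurableSpace Ω] (Pr : Measure Ω)
    (Z : ℕ → Ω → M.AugState γ ν × A × M.AugState γ ν) : Prop where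
  meas : ∀ k z, MeasurableSet (Z k ⁻¹' {z})
  indep : iIndepFun (m := fun _ => ⊤) Z Pr
  law : ∀ k y a y', Pr.real (Z k ⁻¹' {(y, a, y')}) = occSA μ y a * M.augP y a y'

end CMDP

/-! The discounted occupation measure `d` satisfies `d = (1 - γ) δ_init + γ d P`. It need not be
invariant under the chain, but `γ d P ≤ d` pointwise. With `2ab ≤ a² + b²` this gives `γ ⟨V, P V⟩_d
≤ (1 + γ)/2 ‖V‖_d²` (`discounted_cross_term_le`), hence `v · A v ≥ (1 - γ)/2 ‖Φ v‖_d²`. Independence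
of the features on the support of `d` bounds `‖Φ v‖_d²` below by a multiple of `v · v`, so `A` is
invertible.

Moreover `b - A v = Φᵀ diag(d) (B[Φ v] - Φ v)` (`tdB_sub_tdA_mulVec`). So `A v = b` is the normal
equation for projecting `B[Φ v]` onto the span of the features with result `Φ v`, and each
characterization of `v*` is a rewording of it.

The same identity gives the mean TD update at `v` as `-A (v - v*)`, a field pointing back to `v*`
with linear strength. The squared distance `L` to `v*` therefore satisfies `E[L' + 1 | past] ≤ (1 +
K ζ²)(L + 1) - 2 c ζ L`. An almost-supermartingale argument in the manner of Robbins and Siegmund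
then shows that `L` converges and that `∑ ζ L` is finite; since `∑ ζ = ∞`, the limit is zero. -/

/-! ### Almost-supermartingale convergence -/

/-- A deterministic criterion for a nonnegative sequence to tend to zero: it converges, and its
weighted series is bounded although the weights are not summable. -/
theorem tendsto_zero_of_weighted_sum_bounded {ζ W : ℕ → ℝ} {w B : ℝ} (hζ0 : ∀ k, 0 ≤ ζ k)
    (hζ : Tendsto (fun n => ∑ k ∈ Finset.range n, ζ k) atTop atTop) (hW0 : ∀ k, 0 ≤ W k)
    (hW : Tendsto W atTop (𝓝 w)) (hB : ∀ n, ∑ k ∈ Finset.range n, ζ k * W k ≤ B) :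
    Tendsto W atTop (𝓝 0) := by
  have hw : 0 ≤ w := ge_of_tendsto' hW hW0
  rcases hw.eq_or_lt with h | h
  · rwa [h]
  -- If `w > 0`, then `W` exceeds `w / 2` from some `N` on, and the weighted sums grow with those of
  -- `ζ`, up to the terms before `N`.
  exfalso
  obtain ⟨N, hN⟩ := eventually_atTop.1 (hW.eventually (lt_mem_nhds (half_lt_self h)))
  have key : ∀ n, w / 2 * ∑ k ∈ Finset.range n, ζ k
      ≤ B + w / 2 * ∑ k ∈ Finset.range N, ζ k := by
    intro n
    have h1 : ∑ k ∈ Finset.range n, ζ k * (w / 2)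
        ≤ ∑ k ∈ Finset.range n, (ζ k * W k + if k < N then ζ k * (w / 2) else 0) := by
      refine Finset.sum_le_sum fun k _ => ?_
      split_ifs with hk
      · linarith [mul_nonneg (hζ0 k) (hW0 k)]
      · linarith [mul_le_mul_of_nonneg_left (hN k (not_lt.1 hk)).le (hζ0 k)]
    have h2 : ∑ k ∈ Finset.range n, (if k < N then ζ k * (w / 2) else 0)
        ≤ ∑ k ∈ Finset.range N, ζ k * (w / 2) := by
      rw [← Finset.sum_filter]
      refine Finset.sum_le_sum_of_subset_of_nonneg (fun k hk => ?_) fun k _ _ =>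
        mul_nonneg (hζ0 k) (half_pos h).le
      simpa using (Finset.mem_filter.1 hk).2
    rw [Finset.sum_add_distrib] at h1
    have h3 := hB n
    simp only [← Finset.sum_mul] at h1 h2
    linarith
  obtain ⟨n, hn⟩ := ((hζ.const_mul_atTop (half_pos h)).eventually
    (eventually_gt_atTop (B + w / 2 * ∑ k ∈ Finset.range N, ζ k))).exists
  exact absurd (key n) (not_le.2 hn)

/-- Martingale convergence for the submartingale `-S`: nonnegativity and decreasing integrals bound
its L¹ norms by `∫ S 0`. -/
theorem ae_tendsto_of_nonneg_of_setIntegral_succ_le {Ω : Type*} [mΩ : MeasurableSpace Ω]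
    {Pr : Measure Ω} [IsFiniteMeasure Pr] (ℱ : Filtration ℕ mΩ) {S : ℕ → Ω → ℝ}
    (hadp : StronglyAdapted ℱ S) (hint : ∀ k, Integrable (S k) Pr) (h0 : ∀ k ω, 0 ≤ S k ω)
    (hle : ∀ k, ∀ s : Set Ω, MeasurableSet[ℱ k] s →
      ∫ ω in s, S (k + 1) ω ∂Pr ≤ ∫ ω in s, S k ω ∂Pr) :
    ∀ᵐ ω ∂Pr, ∃ c, Tendsto (fun k => S k ω) atTop (𝓝 c) := by
  have hsup := supermartingale_of_setIntegral_succ_le hadp hint hle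
  have hbd : ∀ k, eLpNorm ((-S) k) 1 Pr ≤ ((∫ ω, S 0 ω ∂Pr).toNNReal : ENNReal) := by
    intro k
    have h1 : ∫ ω, S k ω ∂Pr ≤ ∫ ω, S 0 ω ∂Pr := by
      simpa using hsup.setIntegral_le (Nat.zero_le k) MeasurableSet.univ
    rw [Pi.neg_apply, eLpNorm_neg, eLpNorm_one_eq_lintegral_enorm,
      ← ofReal_integral_norm_eq_lintegral_enorm (hint k)]
    refine ENNReal.ofReal_le_ofReal ?_
    simpa only [Real.norm_of_nonneg (h0 k _)] using h1
  filter_upwards [hsup.neg.exists_ae_tendsto_of_bdd hbd] with ω ⟨c, hc⟩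
  exact ⟨-c, by simpa using hc.neg⟩

/-- A nonnegative adapted process which is a supermartingale up to summable multiplicative errors
`a k` and with a drift `-u k * X k`, `u` not summable, tends to zero almost surely. -/
theorem ae_tendsto_zero_of_almost_supermartingale {Ω : Type*} [mΩ : MeasurableSpace Ω]
    {Pr : Measure Ω} [IsFiniteMeasure Pr] (ℱ : Filtration ℕ mΩ) {X : ℕ → Ω → ℝ}
    (hadp : StronglyAdapted ℱ X) (hint : ∀ k, Integrable (X k) Pr) (h0 : ∀ k ω, 0 ≤ X k ω)
    {a u : ℕ → ℝ} (ha0 : ∀ k, 0 ≤ a k) (ha : Summable a) (hu0 : ∀ k, 0 ≤ u k)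
    (hu : Tendsto (fun n => ∑ k ∈ Finset.range n, u k) atTop atTop)
    (hle : ∀ k, ∀ s : Set Ω, MeasurableSet[ℱ k] s → ∫ ω in s, (X (k + 1) ω + 1) ∂Pr
      ≤ ∫ ω in s, ((1 + a k) * (X k ω + 1) - u k * X k ω) ∂Pr) :
    ∀ᵐ ω ∂Pr, Tendsto (fun k => X k ω) atTop (𝓝 0) := by
  set Q : ℕ → ℝ := fun k => ∏ j ∈ Finset.range k, (1 + a j) with hQ
  have hone : ∀ j, 1 ≤ 1 + a j := fun j => by linarith [ha0 j]
  have hQs : ∀ k, Q (k + 1) = Q k * (1 + a k) := fun k => Finset.prod_range_succ _ _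
  have hQ0 : ∀ k, 0 < Q k := fun k =>
    Finset.prod_pos fun j _ => zero_lt_one.trans_le (hone j)
  have hQm : Monotone Q := monotone_nat_of_le_succ fun k => by
    rw [hQs]
    exact le_mul_of_one_le_right (hQ0 k).le (hone k)
  obtain ⟨B, hB⟩ : ∃ B, ∀ k, Q k ≤ B := by
    refine ⟨Real.exp (∑' j, a j), fun k => ?_⟩
    calc Q k ≤ ∏ j ∈ Finset.range k, Real.exp (a j) :=
          Finset.prod_le_prod (fun j _ => zero_le_one.trans (hone j)) fun j _ => by
            rw [add_comm]
            exact Real.add_one_le_exp _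
      _ = Real.exp (∑ j ∈ Finset.range k, a j) := (Real.exp_sum _ _).symm
      _ ≤ _ := Real.exp_le_exp.2 (ha.sum_le_tsum _ fun j _ => ha0 j)
  have hQlim : Tendsto Q atTop (𝓝 (⨆ k, Q k)) :=
    tendsto_atTop_ciSup hQm ⟨B, by rintro _ ⟨k, rfl⟩; exact hB k⟩
  -- Dividing by `Q` cancels the factors `1 + a k`. Both `S` and `S + R` are then nonnegative
  -- supermartingales: `R` accumulates exactly the drift that `S` loses.
  set S : ℕ → Ω → ℝ := fun k ω => (X k ω + 1) / Q k with hS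
  set D : ℕ → Ω → ℝ := fun k ω => u k * X k ω / Q (k + 1) with hD
  set R : ℕ → Ω → ℝ := fun k ω => ∑ j ∈ Finset.range k, D j ω with hR
  have hSint : ∀ k, Integrable (S k) Pr := fun k =>
    ((hint k).add (integrable_const 1)).div_const _
  have hDint : ∀ k, Integrable (D k) Pr := fun k => ((hint k).const_mul _).div_const _
  have hRint : ∀ k, Integrable (R k) Pr := fun k => integrable_finsetSum _ fun j _ => hDint j
  have hSadp : StronglyAdapted ℱ S := fun k =>
    (((hadp k).measurable.add_const 1).div_const _).stronglyMeasurable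
  have hRadp : StronglyAdapted ℱ R := fun k =>
    (Finset.measurable_fun_sum _ fun j hj => (((hadp j).measurable.mono
      (ℱ.mono (Finset.mem_range.1 hj).le) le_rfl).const_mul _).div_const _).stronglyMeasurable
  have hS0 : ∀ k ω, 0 ≤ S k ω := fun k ω =>
    div_nonneg (add_nonneg (h0 k ω) zero_le_one) (hQ0 k).le
  have hD0 : ∀ k ω, 0 ≤ D k ω := fun k ω =>
    div_nonneg (mul_nonneg (hu0 k) (h0 k ω)) (hQ0 _).le
  have hR0 : ∀ k ω, 0 ≤ R k ω := fun k ω => Finset.sum_nonneg fun j _ => hD0 j ω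
  have hmain : ∀ k, ∀ s : Set Ω, MeasurableSet[ℱ k] s → ∫ ω in s, S (k + 1) ω ∂Pr
      ≤ ∫ ω in s, S k ω ∂Pr - ∫ ω in s, D k ω ∂Pr := by
    intro k s hs
    have h1 := div_le_div_of_nonneg_right (hle k s hs) (hQ0 (k + 1)).le
    rw [← integral_div, ← integral_div] at h1
    rw [← integral_sub (hSint k).integrableOn (hDint k).integrableOn]
    refine h1.trans (le_of_eq ?_)
    congr 1
    funext ω
    simp only [hS, hD]
    rw [sub_div, hQs, mul_comm (Q k), mul_div_mul_left _ _ (zero_lt_one.trans_le (hone k)).ne']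
  have hSle : ∀ k, ∀ s : Set Ω, MeasurableSet[ℱ k] s →
      ∫ ω in s, S (k + 1) ω ∂Pr ≤ ∫ ω in s, S k ω ∂Pr := fun k s hs =>
    (hmain k s hs).trans (sub_le_self _ (integral_nonneg (hD0 k)))
  have hSRle : ∀ k, ∀ s : Set Ω, MeasurableSet[ℱ k] s →
      ∫ ω in s, (S + R) (k + 1) ω ∂Pr ≤ ∫ ω in s, (S + R) k ω ∂Pr := by
    intro k s hs
    have h1 := hmain k s hs
    have h2 : ∫ ω in s, R (k + 1) ω ∂Pr = ∫ ω in s, R k ω ∂Pr + ∫ ω in s, D k ω ∂Pr := by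
      rw [← integral_add (hRint k).integrableOn (hDint k).integrableOn]
      simp only [hR, Finset.sum_range_succ]
    simp only [Pi.add_apply]
    rw [integral_add (hSint (k + 1)).integrableOn (hRint (k + 1)).integrableOn,
      integral_add (hSint k).integrableOn (hRint k).integrableOn]
    linarith
  filter_upwards [ae_tendsto_of_nonneg_of_setIntegral_succ_le ℱ hSadp hSint hS0 hSle,
    ae_tendsto_of_nonneg_of_setIntegral_succ_le ℱ (hSadp.add hRadp)
      (fun k => (hSint k).add (hRint k)) (fun k ω => add_nonneg (hS0 k ω) (hR0 k ω)) hSRle]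
    with ω ⟨l, hl⟩ ⟨b, hb⟩
  have hXlim : Tendsto (fun k => X k ω) atTop (𝓝 (l * (⨆ k, Q k) - 1)) := by
    refine ((hl.mul hQlim).sub_const 1).congr fun k => ?_
    simp only [hS]
    rw [div_mul_cancel₀ _ (hQ0 k).ne']
    ring
  obtain ⟨C, hC⟩ := hb.bddAbove_range
  refine tendsto_zero_of_weighted_sum_bounded hu0 hu (fun k => h0 k ω) hXlim (B := C * B)
    fun n => ?_
  -- Since `S ≥ 0`, the bound on `S + R` passes to `R`; undoing the division by `Q (k + 1) ≤ B`
  -- costs the factor `B`.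
  have h1 : R n ω ≤ C := by
    have := hC ⟨n, rfl⟩
    simp only [Pi.add_apply] at this
    linarith [hS0 n ω]
  have hB0 : 0 < B := (hQ0 0).trans_le (hB 0)
  rw [← div_le_iff₀ hB0, Finset.sum_div]
  refine le_trans (Finset.sum_le_sum fun k _ => ?_) h1
  exact div_le_div_of_nonneg_left (mul_nonneg (hu0 k) (h0 k ω)) (hQ0 _) (hB _)

/-! ### Stochastic approximation with finitely valued samples -/

/-- The filtration of the samples strictly before time `k`. -/
def pastFiltration {Ω T : Type*} [mΩ : MeasurableSpace Ω] (Z : ℕ → Ω → T)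
    (hZ : ∀ k, Measurable[mΩ, ⊤] (Z k)) : Filtration ℕ mΩ where
  seq k := ⨆ j ∈ Set.Iio k, MeasurableSpace.comap (Z j) ⊤
  mono' _ _ hij := biSup_mono fun _ hj => lt_of_lt_of_le hj hij
  le' _ := iSup₂_le fun j _ => (hZ j).comap_le

theorem measurable_of_measurableSet_preimage_singleton {Ω T : Type*} [mΩ : MeasurableSpace Ω]
    [Countable T] {f : Ω → T} (hf : ∀ z, MeasurableSet (f ⁻¹' {z})) : Measurable[mΩ, ⊤] f := by
  intro s _
  rw [← Set.biUnion_preimage_singleton]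
  exact MeasurableSet.biUnion s.to_countable fun z _ => hf z

/-- The recursion `v (k + 1) = v k + ζ k • g (v k) (z k)`. -/
def stochIter {E T : Type*} [AddCommGroup E] [Module ℝ E] (g : E → T → E) (ζ : ℕ → ℝ) (v0 : E)
    (z : ℕ → T) : ℕ → E
  | 0 => v0
  | k + 1 => stochIter g ζ v0 z k + ζ k • g (stochIter g ζ v0 z k) (z k)

section StochasticApproximation

variable {Ω T : Type*} [Fintype T] {κ : ℕ} {g : (Fin κ → ℝ) → T → (Fin κ → ℝ)} {Z : ℕ → Ω → T}

/-- Finitely many samples lead to finitely many iterates at each time, so integrability needs no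
moment estimate. -/
theorem finite_range_stochIter (ζ : ℕ → ℝ) (v0 : Fin κ → ℝ) (k : ℕ) :
    (Set.range fun ω => stochIter g ζ v0 (fun j => Z j ω) k).Finite := by
  induction k with
  | zero =>
    refine (Set.finite_singleton v0).subset ?_
    rintro _ ⟨ω, rfl⟩
    rfl
  | succ k ih =>
    refine (Set.Finite.image2 (fun v z => v + ζ k • g v z) ih (Set.finite_univ (α := T))).subset ?_
    rintro _ ⟨ω, rfl⟩
    exact ⟨_, ⟨ω, rfl⟩, Z k ω, trivial, rfl⟩

theorem measurable_comp_of_fintype {E F : Type*} [MeasurableSpace E] [MeasurableSpace F]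
    {m : MeasurableSpace Ω} {V : Ω → E} {Y : Ω → T} {f : E → T → F}
    (hV : Measurable[m] V) (hY : Measurable[m, ⊤] Y) (hf : ∀ z, Measurable fun v => f v z) :
    Measurable[m] fun ω => f (V ω) (Y ω) := by
  let _ : MeasurableSpace T := ⊤
  have h : Measurable fun p : E × T => f p.1 p.2 := measurable_from_prod_countable_left hf
  exact h.comp (hV.prodMk hY)

variable [mΩ : MeasurableSpace Ω] {Pr : Measure Ω} [IsProbabilityMeasure Pr]

theorem measurable_stochIter (hZ : ∀ k, Measurable[mΩ, ⊤] (Z k))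
    (hg : ∀ z, Continuous fun v => g v z) (ζ : ℕ → ℝ) (v0 : Fin κ → ℝ) (k : ℕ) :
    Measurable[pastFiltration Z hZ k] fun ω => stochIter g ζ v0 (fun j => Z j ω) k := by
  induction k with
  | zero => exact measurable_const
  | succ k ih =>
    refine measurable_comp_of_fintype (f := fun v z => v + ζ k • g v z)
      (ih.mono ((pastFiltration Z hZ).mono k.le_succ) le_rfl) ?_ fun z => ?_
    · refine Measurable.of_comap_le ?_
      exact le_iSup₂_of_le (f := fun j (_ : j ∈ Set.Iio (k + 1)) =>
        MeasurableSpace.comap (Z j) ⊤) k (Nat.lt_succ_self k) le_rfl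
    · exact (continuous_id.add ((hg z).const_smul (ζ k))).measurable

theorem integrable_comp_stochIter (hZ : ∀ k, Measurable[mΩ, ⊤] (Z k))
    (hg : ∀ z, Continuous fun v => g v z) (ζ : ℕ → ℝ) (v0 : Fin κ → ℝ) (k : ℕ)
    {f : (Fin κ → ℝ) → ℝ} (hf : Continuous f) :
    Integrable (fun ω => f (stochIter g ζ v0 (fun j => Z j ω) k)) Pr := by
  obtain ⟨C, hC⟩ := (((finite_range_stochIter (Z := Z) (g := g) ζ v0 k).image
    fun v => ‖f v‖).bddAbove)
  refine Integrable.of_bound (hf.measurable.comp ((measurable_stochIter hZ hg ζ v0 k).mono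
    ((pastFiltration Z hZ).le k) le_rfl)).aestronglyMeasurable C (ae_of_all _ fun ω => ?_)
  exact hC ⟨_, ⟨ω, rfl⟩, rfl⟩

/-- Integrating out the current sample, which is independent of the past. -/
theorem setIntegral_comp_sample (hZ : ∀ k, Measurable[mΩ, ⊤] (Z k))
    (hind : iIndepFun (m := fun _ => ⊤) Z Pr) {p : T → ℝ}
    (hp : ∀ k z, Pr.real (Z k ⁻¹' {z}) = p z)
    (hg : ∀ z, Continuous fun v => g v z) (ζ : ℕ → ℝ) (v0 : Fin κ → ℝ) (k : ℕ)
    {f : (Fin κ → ℝ) → T → ℝ} (hf : ∀ z, Continuous fun v => f v z) {s : Set Ω}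
    (hs : MeasurableSet[pastFiltration Z hZ k] s) :
    ∫ ω in s, f (stochIter g ζ v0 (fun j => Z j ω) k) (Z k ω) ∂Pr
      = ∫ ω in s, ∑ z, p z * f (stochIter g ζ v0 (fun j => Z j ω) k) z ∂Pr := by
  classical
  set V : Ω → Fin κ → ℝ := fun ω => stochIter g ζ v0 (fun j => Z j ω) k with hVdef
  have hV : Measurable[pastFiltration Z hZ k] V := measurable_stochIter hZ hg ζ v0 k
  have hsm : MeasurableSet s := (pastFiltration Z hZ).le k _ hs
  have hmeas : ∀ z, MeasurableSet (Z k ⁻¹' {z}) := fun z => hZ k trivial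
  have hint : ∀ z, Integrable (fun ω => f (V ω) z) Pr := fun z =>
    integrable_comp_stochIter hZ hg ζ v0 k (hf z)
  -- Splitting by the value of `Z k` turns each term into a past-measurable factor times an
  -- indicator of the current sample.
  have hsplit : ∀ ω, f (V ω) (Z k ω)
      = ∑ z, (Z k ⁻¹' {z}).indicator (fun ω => f (V ω) z) ω := by
    intro ω
    rw [Finset.sum_eq_single (Z k ω)]
    · simp
    · intro z _ hz
      refine Set.indicator_of_notMem ?_ _
      exact fun h => hz (Set.mem_singleton_iff.1 h).symm
    · simp
  change ∫ ω in s, f (V ω) (Z k ω) ∂Pr = ∫ ω in s, ∑ z, p z * f (V ω) z ∂Pr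
  simp_rw [hsplit]
  rw [integral_finsetSum _ fun z _ => ((hint z).indicator (hmeas z)).integrableOn,
    integral_finsetSum _ fun z _ => ((hint z).const_mul _).integrableOn]
  refine Finset.sum_congr rfl fun z _ => ?_
  -- The past involves only indices below `k`, so it is independent of `Z k`.
  have hdisj : Disjoint (Set.Iio k) {k} := Set.disjoint_singleton_right.2 (lt_irrefl k)
  have hI := indep_iSup_of_disjoint (fun j => (hZ j).comap_le) hind hdisj
  have hX : Measurable[pastFiltration Z hZ k] (s.indicator fun ω => f (V ω) z) :=
    ((hf z).measurable.comp hV).indicator hs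
  have hY : Measurable[⨆ j ∈ ({k} : Set ℕ), MeasurableSpace.comap (Z j) ⊤]
      ((Z k ⁻¹' {z}).indicator fun _ => (1 : ℝ)) := by
    refine Measurable.indicator (@measurable_const _ _ _ _ (1 : ℝ)) ?_
    rw [iSup_singleton]
    exact ⟨{z}, trivial, rfl⟩
  have hXY : IndepFun (s.indicator fun ω => f (V ω) z)
      ((Z k ⁻¹' {z}).indicator fun _ => (1 : ℝ)) Pr :=
    indep_of_indep_of_le_left (indep_of_indep_of_le_right hI hY.comap_le) hX.comap_le
  have hprod := hXY.integral_fun_mul_eq_mul_integral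
    ((hint z).indicator hsm).aestronglyMeasurable
    ((integrable_const (1 : ℝ)).indicator (hmeas z)).aestronglyMeasurable
  rw [integral_indicator hsm, integral_indicator_const _ (hmeas z), hp, smul_eq_mul,
    mul_one] at hprod
  rw [integral_const_mul, mul_comm, ← hprod, ← integral_indicator hsm]
  refine integral_congr_ae (ae_of_all _ fun ω => ?_)
  by_cases h1 : ω ∈ s <;> by_cases h2 : ω ∈ Z k ⁻¹' {z} <;> simp [h1, h2]

/-- **Convergence of stochastic approximation** with independent, identically distributed samples
in a finite type: if the mean field is strongly dissipative around `vstar` and the second moments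
grow at most quadratically, then the iterates converge almost surely to `vstar`. -/
theorem ae_tendsto_stochIter (hZ : ∀ k z, MeasurableSet (Z k ⁻¹' {z}))
    (hind : iIndepFun (m := fun _ => ⊤) Z Pr) {p : T → ℝ}
    (hp : ∀ k z, Pr.real (Z k ⁻¹' {z}) = p z)
    (hg : ∀ z, Continuous fun v => g v z) {ζ : ℕ → ℝ} (hζ0 : ∀ k, 0 ≤ ζ k)
    (hζ1 : Tendsto (fun n => ∑ k ∈ Finset.range n, ζ k) atTop atTop)
    (hζ2 : Summable fun k => ζ k ^ 2) {vstar : Fin κ → ℝ} {c K : ℝ} (hc : 0 < c) (hK : 0 ≤ K)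
    (hdrift : ∀ v, ∑ z, p z * ((v - vstar) ⬝ᵥ g v z) ≤ -c * ((v - vstar) ⬝ᵥ (v - vstar)))
    (hgrowth : ∀ v, ∑ z, p z * (g v z ⬝ᵥ g v z) ≤ K * ((v - vstar) ⬝ᵥ (v - vstar) + 1))
    (v0 : Fin κ → ℝ) :
    ∀ᵐ ω ∂Pr, Tendsto (fun k => stochIter g ζ v0 (fun j => Z j ω) k) atTop (𝓝 vstar) := by
  classical
  have hZm : ∀ k, Measurable[mΩ, ⊤] (Z k) := fun k =>
    measurable_of_measurableSet_preimage_singleton (hZ k)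
  set ℱ := pastFiltration Z hZm with hℱ
  set L : (Fin κ → ℝ) → ℝ := fun v => (v - vstar) ⬝ᵥ (v - vstar) with hL
  have hLc : Continuous L := by
    simp only [hL, dotProduct]
    fun_prop
  have hL0 : ∀ v, 0 ≤ L v := fun v => Finset.sum_nonneg fun i _ => mul_self_nonneg _
  have hpsum : ∑ z, p z = 1 := by
    simp_rw [← hp 0]
    rw [← measureReal_biUnion_finset (fun a _ b _ hab => ?_) fun z _ => hZ 0 z]
    · have : (⋃ z ∈ (Finset.univ : Finset T), Z 0 ⁻¹' {z}) = Set.univ := by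
        ext ω
        simp
      rw [this, probReal_univ]
    · exact Disjoint.preimage _ (by simpa using hab)
  -- one step of the expected squared distance
  have hstep : ∀ k v, ∑ z, p z * (L (v + ζ k • g v z) + 1)
      ≤ (1 + K * ζ k ^ 2) * (L v + 1) - 2 * c * ζ k * L v := by
    intro k v
    have hexp : ∀ z, p z * (L (v + ζ k • g v z) + 1) = p z * (L v + 1)
        + 2 * ζ k * (p z * ((v - vstar) ⬝ᵥ g v z)) + ζ k ^ 2 * (p z * (g v z ⬝ᵥ g v z)) := by
      intro z
      have : v + ζ k • g v z - vstar = (v - vstar) + ζ k • g v z := by abel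
      simp only [hL, this, add_dotProduct, dotProduct_add, smul_dotProduct, dotProduct_smul,
        smul_eq_mul, dotProduct_comm (g v z) (v - vstar)]
      ring
    simp_rw [hexp]
    rw [Finset.sum_add_distrib, Finset.sum_add_distrib, ← Finset.sum_mul, ← Finset.mul_sum,
      ← Finset.mul_sum, hpsum]
    have h1 := mul_le_mul_of_nonneg_left (hdrift v) (mul_nonneg zero_le_two (hζ0 k))
    have h2 := mul_le_mul_of_nonneg_left (hgrowth v) (sq_nonneg (ζ k))
    simp only [hL]
    linarith
  have hLint : ∀ k, Integrable (fun ω => L (stochIter g ζ v0 (fun j => Z j ω) k)) Pr := fun k =>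
    integrable_comp_stochIter hZm hg ζ v0 k hLc
  have hnext : ∀ k z, Continuous fun v => L (v + ζ k • g v z) + 1 := fun k z =>
    (hLc.comp (continuous_id.add ((hg z).const_smul (ζ k)))).add continuous_const
  -- Following `L + 1` rather than `L` turns the constant term of the growth bound into a
  -- multiplicative error.
  have hle : ∀ k, ∀ s : Set Ω, MeasurableSet[ℱ k] s →
      ∫ ω in s, (L (stochIter g ζ v0 (fun j => Z j ω) (k + 1)) + 1) ∂Pr
      ≤ ∫ ω in s, ((1 + K * ζ k ^ 2) * (L (stochIter g ζ v0 (fun j => Z j ω) k) + 1)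
        - 2 * c * ζ k * L (stochIter g ζ v0 (fun j => Z j ω) k)) ∂Pr := by
    intro k s hs
    refine (setIntegral_comp_sample hZm hind hp hg ζ v0 k (hnext k) hs).le.trans
      (setIntegral_mono ?_ ?_ fun ω => hstep k _)
    · exact (integrable_finsetSum _ fun z _ => Integrable.const_mul
        (integrable_comp_stochIter hZm hg ζ v0 k (hnext k z)) _).integrableOn
    · exact ((((hLint k).add (integrable_const 1)).const_mul _).sub
        ((hLint k).const_mul _)).integrableOn
  have hu : Tendsto (fun n => ∑ k ∈ Finset.range n, 2 * c * ζ k) atTop atTop := by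
    simp_rw [← Finset.mul_sum]
    exact hζ1.const_mul_atTop (by positivity)
  filter_upwards [ae_tendsto_zero_of_almost_supermartingale ℱ
    (X := fun k ω => L (stochIter g ζ v0 (fun j => Z j ω) k))
    (fun k => (hLc.measurable.comp (measurable_stochIter hZm hg ζ v0 k)).stronglyMeasurable)
    hLint (fun k ω => hL0 _) (fun k => mul_nonneg hK (sq_nonneg _)) (hζ2.mul_left K)
    (fun k => mul_nonneg (by positivity) (hζ0 k)) hu hle] with ω hzero
  refine tendsto_pi_nhds.2 fun i => tendsto_sub_nhds_zero_iff.1 ?_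
  refine squeeze_zero_norm (fun k => ?_) (by simpa using hzero.sqrt)
  rw [Real.norm_eq_abs]
  refine Real.abs_le_sqrt ?_
  rw [sq]
  exact Finset.single_le_sum (f := fun i => (stochIter g ζ v0 (fun j => Z j ω) k - vstar) i * (stochIter g ζ v0 (fun j => Z j ω) k - vstar) i)
    (fun i _ => mul_self_nonneg _) (Finset.mem_univ i)

end StochasticApproximation

/-! ### The augmented chain and its occupation measure -/

namespace CMDP

section Kernel

variable {X A : Type*} [Fintype X] [Fintype A] {M : CMDP X A} {γ ν : ℝ}

theorem augP_nonneg (y : M.AugState γ ν) (a : A) (y' : M.AugState γ ν) : 0 ≤ M.augP y a y' := by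
  unfold augP
  split_ifs
  · exact zero_le_one
  · exact le_rfl
  · exact mul_nonneg (M.P_nonneg _ _ _) zero_le_one
  · exact mul_nonneg (M.P_nonneg _ _ _) le_rfl

/-- The transition probabilities of the augmented chain under a stationary policy. -/
noncomputable def kernel (μ : Policy M γ ν) (y y' : M.AugState γ ν) : ℝ :=
  ∑ a, μ.prob y a * M.augP y a y'

theorem kernel_nonneg (μ : Policy M γ ν) (y y' : M.AugState γ ν) : 0 ≤ kernel μ y y' :=
  Finset.sum_nonneg fun a _ => mul_nonneg (μ.nonneg y a) (augP_nonneg y a y')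

variable [Fintype (M.AugState γ ν)]

/-- Reachability is closed under transitions of positive probability, so no mass leaves the subtype.
A successor pair of probability zero may be missing from it, but would carry no mass. -/
theorem augP_sum (y : M.AugState γ ν) (a : A) : ∑ y', M.augP y a y' = 1 := by
  classical
  obtain ⟨⟨x, s⟩, hy⟩ := y
  by_cases hx : x = M.xTar
  · subst hx
    rw [Finset.sum_eq_single (⟨(M.xTar, 0), AugReachable.target s hy⟩ : M.AugState γ ν)]
    · simp [augP]
    · rintro ⟨⟨x', s'⟩, h'⟩ _ hne
      have : ¬ (x' = M.xTar ∧ s' = 0) := by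
        rintro ⟨rfl, rfl⟩
        exact hne rfl
      simp [augP, this]
    · simp
  · rw [← Finset.sum_fiberwise _ fun y' : M.AugState γ ν => y'.1.1, ← M.P_sum x a]
    refine Finset.sum_congr rfl fun x' _ => ?_
    rcases (M.P_nonneg x a x').eq_or_lt with h0 | h0
    · rw [← h0]
      refine Finset.sum_eq_zero fun y' hy' => ?_
      have h1 : y'.1.1 = x' := (Finset.mem_filter.1 hy').2
      simp [augP, hx, h1, ← h0]
    · rw [Finset.sum_eq_single
        (⟨(x', (s - M.D x a) / γ), AugReachable.step x s a x' hy hx h0⟩ : M.AugState γ ν)]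
      · simp [augP, hx]
      · rintro ⟨⟨x'', s'⟩, h'⟩ hm hne
        have h1 : x'' = x' := (Finset.mem_filter.1 hm).2
        subst h1
        have : s' ≠ (s - M.D x a) / γ := by
          rintro rfl
          exact hne rfl
        simp [augP, hx, this]
      · simp

variable (μ : Policy M γ ν)

theorem kernel_sum (y : M.AugState γ ν) : ∑ y', kernel μ y y' = 1 := by
  unfold kernel
  rw [Finset.sum_comm]
  simp_rw [← Finset.mul_sum, augP_sum, mul_one, μ.sum_eq_one]

theorem stateProb_succ (k : ℕ) (y : M.AugState γ ν) :
    stateProb μ (k + 1) y = ∑ z, stateProb μ k z * kernel μ z y := by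
  simp only [stateProb, kernel, Finset.mul_sum, mul_assoc]

theorem stateProb_nonneg (k : ℕ) (y : M.AugState γ ν) : 0 ≤ stateProb μ k y := by
  induction k generalizing y with
  | zero =>
    simp only [stateProb]
    split_ifs
    · exact zero_le_one
    · exact le_rfl
  | succ k ih =>
    rw [stateProb_succ]
    exact Finset.sum_nonneg fun z _ => mul_nonneg (ih z) (kernel_nonneg μ z y)

theorem stateProb_sum (k : ℕ) : ∑ y, stateProb μ k y = 1 := by
  classical
  induction k with
  | zero => simp [stateProb]
  | succ k ih =>
    simp_rw [stateProb_succ]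
    rw [Finset.sum_comm]
    simp_rw [← Finset.mul_sum, kernel_sum, mul_one, ih]

theorem stateProb_le_one (k : ℕ) (y : M.AugState γ ν) : stateProb μ k y ≤ 1 :=
  (Finset.single_le_sum (fun z _ => stateProb_nonneg μ k z) (Finset.mem_univ y)).trans_eq
    (stateProb_sum μ k)

theorem summable_discounted_stateProb (hγ0 : 0 < γ) (hγ1 : γ < 1) (y : M.AugState γ ν) :
    Summable fun k : ℕ => γ ^ k * stateProb μ k y :=
  Summable.of_nonneg_of_le (fun k => mul_nonneg (pow_nonneg hγ0.le k) (stateProb_nonneg μ k y))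
    (fun k => mul_le_of_le_one_right (pow_nonneg hγ0.le k) (stateProb_le_one μ k y))
    (summable_geometric_of_lt_one hγ0.le hγ1)

theorem occ_nonneg (hγ0 : 0 < γ) (hγ1 : γ < 1) (y : M.AugState γ ν) : 0 ≤ occ μ y :=
  mul_nonneg (sub_nonneg.2 hγ1.le)
    (tsum_nonneg fun k => mul_nonneg (pow_nonneg hγ0.le k) (stateProb_nonneg μ k y))

/-- The balance equation of the discounted occupation measure. -/
theorem occ_eq (hγ0 : 0 < γ) (hγ1 : γ < 1) (y : M.AugState γ ν) :
    occ μ y = (1 - γ) * stateProb μ 0 y + γ * ∑ z, occ μ z * kernel μ z y := by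
  have hs := summable_discounted_stateProb μ hγ0 hγ1
  unfold occ
  rw [(hs y).tsum_eq_zero_add]
  have h : ∑' k : ℕ, γ ^ (k + 1) * stateProb μ (k + 1) y
      = γ * ∑ z, (∑' k : ℕ, γ ^ k * stateProb μ k z) * kernel μ z y := by
    simp_rw [← tsum_mul_right]
    rw [← Summable.tsum_finsetSum fun z _ => (hs z).mul_right _, ← tsum_mul_left]
    refine tsum_congr fun k => ?_
    rw [stateProb_succ, Finset.mul_sum, Finset.mul_sum]
    exact Finset.sum_congr rfl fun z _ => by ring
  rw [h]
  simp only [mul_assoc, ← Finset.mul_sum, pow_zero, one_mul]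
  ring

/-- The substitute for stationarity, obtained by dropping the initial mass. -/
theorem occ_balance_le (hγ0 : 0 < γ) (hγ1 : γ < 1) (y : M.AugState γ ν) :
    γ * ∑ z, occ μ z * kernel μ z y ≤ occ μ y := by
  rw [occ_eq μ hγ0 hγ1 y]
  linarith [mul_nonneg (sub_nonneg.2 hγ1.le) (stateProb_nonneg μ 0 y)]

/-- The discounted transition operator is bounded away from the identity in the inner product
weighted by the occupation measure. -/
theorem discounted_cross_term_le (hγ0 : 0 < γ) (hγ1 : γ < 1) (V : M.AugState γ ν → ℝ) :
    γ * ∑ y, occ μ y * V y * ∑ y', kernel μ y y' * V y' ≤ (1 + γ) / 2 * occNormSq μ V := by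
  have h1 : ∑ y, occ μ y * V y * ∑ y', kernel μ y y' * V y'
      ≤ ∑ y, ∑ y', (occ μ y * V y ^ 2 * kernel μ y y' / 2
        + occ μ y * kernel μ y y' * V y' ^ 2 / 2) := by
    refine Finset.sum_le_sum fun y _ => ?_
    rw [Finset.mul_sum]
    refine Finset.sum_le_sum fun y' _ => ?_
    have := mul_nonneg (mul_nonneg (occ_nonneg μ hγ0 hγ1 y) (kernel_nonneg μ y y'))
      (sq_nonneg (V y - V y'))
    linarith
  have h2 : ∑ y, ∑ y', (occ μ y * V y ^ 2 * kernel μ y y' / 2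
        + occ μ y * kernel μ y y' * V y' ^ 2 / 2)
      = occNormSq μ V / 2 + (∑ y', (∑ y, occ μ y * kernel μ y y') * V y' ^ 2) / 2 := by
    simp_rw [Finset.sum_add_distrib, ← Finset.sum_div, ← Finset.mul_sum, kernel_sum, mul_one]
    congr 2
    rw [Finset.sum_comm]
    simp_rw [Finset.sum_mul]
  -- After multiplication by `γ`, the two halves contribute `γ / 2` (rows of the kernel sum to one)
  -- and `1 / 2` (balance).
  have h3 : γ * ∑ y', (∑ y, occ μ y * kernel μ y y') * V y' ^ 2 ≤ occNormSq μ V := by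
    rw [Finset.mul_sum]
    refine Finset.sum_le_sum fun y _ => ?_
    rw [← mul_assoc]
    exact mul_le_mul_of_nonneg_right (occ_balance_le μ hγ0 hγ1 y) (sq_nonneg _)
  rw [h2] at h1
  have h4 := mul_le_mul_of_nonneg_left h1 hγ0.le
  linarith

theorem occNormSq_nonneg (hγ0 : 0 < γ) (hγ1 : γ < 1) (V : M.AugState γ ν → ℝ) :
    0 ≤ occNormSq μ V :=
  Finset.sum_nonneg fun y _ => mul_nonneg (occ_nonneg μ hγ0 hγ1 y) (sq_nonneg _)

/-- `occNormSq` is only a seminorm squared; its null functions are those vanishing wherever `occ` is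
positive. -/
theorem occ_mul_eq_zero_of_occNormSq_eq_zero (hγ0 : 0 < γ) (hγ1 : γ < 1)
    {V : M.AugState γ ν → ℝ} (h : occNormSq μ V = 0) (y : M.AugState γ ν) :
    occ μ y * V y = 0 := by
  have := (Finset.sum_eq_zero_iff_of_nonneg fun y _ =>
    mul_nonneg (occ_nonneg μ hγ0 hγ1 y) (sq_nonneg (V y))).1 h y (Finset.mem_univ y)
  rcases mul_eq_zero.1 this with h | h
  · rw [h, zero_mul]
  · rw [pow_eq_zero_iff two_ne_zero] at h
    rw [h, mul_zero]

end Kernel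

/-! ### Coercivity, normal equations and projections -/

section LinearAlgebra

variable {X A : Type*} [Fintype X] [Fintype A] {M : CMDP X A} {γ ν : ℝ}
  {κ : ℕ}

theorem featMat_mulVec_apply (φ : M.AugState γ ν → Fin κ → ℝ) (v : Fin κ → ℝ) (y : M.AugState γ ν) :
    (featMat φ *ᵥ v) y = φ y ⬝ᵥ v := rfl

variable [Fintype (M.AugState γ ν)] (μ : Policy M γ ν) (φ : M.AugState γ ν → Fin κ → ℝ)

/-- The vector `Φᵀ diag(occ) V`. -/
noncomputable def occFeat (V : M.AugState γ ν → ℝ) : Fin κ → ℝ :=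
  fun i => ∑ y, occ μ y * φ y i * V y

theorem proj_eq (V : M.AugState γ ν → ℝ) :
    proj μ φ V = featMat φ *ᵥ ((gram μ φ)⁻¹ *ᵥ occFeat μ φ V) := rfl

theorem occFeat_sub (V W : M.AugState γ ν → ℝ) :
    occFeat μ φ (V - W) = occFeat μ φ V - occFeat μ φ W := by
  ext i
  simp only [occFeat, Pi.sub_apply, mul_sub, Finset.sum_sub_distrib]

theorem gram_mulVec (v : Fin κ → ℝ) : gram μ φ *ᵥ v = occFeat μ φ (featMat φ *ᵥ v) := by
  ext i
  simp only [occFeat, featMat_mulVec_apply]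
  simp only [Matrix.mulVec, dotProduct, gram, Finset.sum_mul, Finset.mul_sum]
  rw [Finset.sum_comm]
  exact Finset.sum_congr rfl fun y _ => Finset.sum_congr rfl fun j _ => by ring

theorem dotProduct_occFeat (v : Fin κ → ℝ) (V : M.AugState γ ν → ℝ) :
    v ⬝ᵥ occFeat μ φ V = ∑ y, occ μ y * (featMat φ *ᵥ v) y * V y := by
  simp only [occFeat, featMat_mulVec_apply, dotProduct, Finset.sum_mul, Finset.mul_sum]
  rw [Finset.sum_comm]
  exact Finset.sum_congr rfl fun y _ => Finset.sum_congr rfl fun j _ => by ring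

theorem tdA_mulVec (v : Fin κ → ℝ) : tdA μ φ *ᵥ v = occFeat μ φ (fun y =>
    (featMat φ *ᵥ v) y - γ * ∑ y', kernel μ y y' * (featMat φ *ᵥ v) y') := by
  ext i
  have h : ∀ y, ∑ a, occSA μ y a * (φ y i * ((φ y ⬝ᵥ v)
      - γ * ∑ y', M.augP y a y' * (φ y' ⬝ᵥ v)))
      = occ μ y * φ y i * ((φ y ⬝ᵥ v) - γ * ∑ y', kernel μ y y' * (φ y' ⬝ᵥ v)) := by
    intro y
    have h1 : ∑ y', kernel μ y y' * (φ y' ⬝ᵥ v)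
        = ∑ a, μ.prob y a * ∑ y', M.augP y a y' * (φ y' ⬝ᵥ v) := by
      simp only [kernel, Finset.sum_mul, Finset.mul_sum]
      rw [Finset.sum_comm]
      exact Finset.sum_congr rfl fun y _ => Finset.sum_congr rfl fun j _ => by ring
    have h2 : (φ y ⬝ᵥ v) = ∑ a, μ.prob y a * (φ y ⬝ᵥ v) := by
      rw [← Finset.sum_mul, μ.sum_eq_one, one_mul]
    rw [h1, h2, Finset.mul_sum, ← Finset.sum_sub_distrib, Finset.mul_sum, ← h2]
    exact Finset.sum_congr rfl fun a _ => by
      simp only [occSA]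
      ring
  simp only [occFeat, featMat_mulVec_apply]
  rw [← Finset.sum_congr rfl fun y _ => h y]
  simp only [Matrix.mulVec, tdA, dotProduct, Finset.sum_mul, Finset.mul_sum, mul_sub,
    Finset.sum_sub_distrib, sub_mul]
  rw [Finset.sum_comm (s := (Finset.univ : Finset (Fin κ)))]
  rw [Finset.sum_comm (s := (Finset.univ : Finset (Fin κ)))]
  congr 1
  · refine Finset.sum_congr rfl fun y _ => ?_
    rw [Finset.sum_comm]
    exact Finset.sum_congr rfl fun a _ => Finset.sum_congr rfl fun j _ => by ring
  · refine Finset.sum_congr rfl fun y _ => ?_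
    rw [Finset.sum_comm]
    refine Finset.sum_congr rfl fun a _ => ?_
    rw [Finset.sum_comm]
    exact Finset.sum_congr rfl fun a _ => Finset.sum_congr rfl fun j _ => by ring

theorem bellman_eq (α lam : ℝ) (V : M.AugState γ ν → ℝ) (y : M.AugState γ ν) :
    bellman μ α lam V y = (∑ a, μ.prob y a * M.augCost α lam y a)
      + γ * ∑ y', kernel μ y y' * V y' := by
  simp only [bellman, kernel, mul_add, Finset.sum_add_distrib, Finset.sum_mul, Finset.mul_sum]
  congr 1
  rw [Finset.sum_comm]
  exact Finset.sum_congr rfl fun y _ => Finset.sum_congr rfl fun j _ => by ring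

/-- The normal equations of the projected Bellman equation. -/
theorem tdB_sub_tdA_mulVec (α lam : ℝ) (v : Fin κ → ℝ) :
    tdB μ φ α lam - tdA μ φ *ᵥ v
      = occFeat μ φ (bellman μ α lam (featMat φ *ᵥ v)) - gram μ φ *ᵥ v := by
  have hB : tdB μ φ α lam = occFeat μ φ fun y => ∑ a, μ.prob y a * M.augCost α lam y a := by
    ext i
    simp only [tdB, occFeat, occSA, Finset.mul_sum]
    exact Finset.sum_congr rfl fun y _ => Finset.sum_congr rfl fun j _ => by ring
  rw [hB, tdA_mulVec, gram_mulVec, ← occFeat_sub, ← occFeat_sub]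
  congr 1
  ext y
  simp only [Pi.sub_apply, bellman_eq]
  ring

/-- Coercivity of `A`: the constant is `1 - (1 + γ)/2`, what the cross term leaves of the squared
norm. -/
theorem dotProduct_tdA_mulVec (v : Fin κ → ℝ) (hγ0 : 0 < γ) (hγ1 : γ < 1) :
    (1 - γ) / 2 * occNormSq μ (featMat φ *ᵥ v) ≤ v ⬝ᵥ tdA μ φ *ᵥ v := by
  rw [tdA_mulVec, dotProduct_occFeat]
  have h := discounted_cross_term_le μ hγ0 hγ1 (featMat φ *ᵥ v)
  have h1 : ∑ y, occ μ y * (featMat φ *ᵥ v) y * ((featMat φ *ᵥ v) y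
      - γ * ∑ y', kernel μ y y' * (featMat φ *ᵥ v) y') = occNormSq μ (featMat φ *ᵥ v)
      - γ * ∑ y, occ μ y * (featMat φ *ᵥ v) y * ∑ y', kernel μ y y' * (featMat φ *ᵥ v) y' := by
    rw [occNormSq, Finset.mul_sum, ← Finset.sum_sub_distrib]
    exact Finset.sum_congr rfl fun y _ => by ring
  rw [h1]
  linarith

variable {μ φ}

theorem IndependentBasis.eq_zero (hφ : IndependentBasis μ φ) {v : Fin κ → ℝ}
    (h : ∀ y, occ μ y * (featMat φ *ᵥ v) y = 0) : v = 0 := by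
  funext i
  refine Fintype.linearIndependent_iff.1 hφ v ?_ i
  funext y
  have h1 := (mul_eq_zero.1 (h y.1)).resolve_left y.2.ne'
  rw [featMat_mulVec_apply, dotProduct] at h1
  simpa [Finset.sum_apply, mul_comm] using h1

/-- The map `v ↦ √occ · Φ v` is linear and injective on a finite-dimensional space, hence
antilipschitz. -/
theorem IndependentBasis.exists_pos_le_occNormSq (hφ : IndependentBasis μ φ) (hγ0 : 0 < γ)
    (hγ1 : γ < 1) :
    ∃ c, 0 < c ∧ ∀ v : Fin κ → ℝ, c * (v ⬝ᵥ v) ≤ occNormSq μ (featMat φ *ᵥ v) := by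
  have h0 := occ_nonneg μ hγ0 hγ1
  let f : (Fin κ → ℝ) →ₗ[ℝ] (M.AugState γ ν → ℝ) :=
    LinearMap.pi fun y => √(occ μ y) • (LinearMap.proj y ∘ₗ (featMat φ).mulVecLin)
  have hf : ∀ v y, f v y = √(occ μ y) * (featMat φ *ᵥ v) y := fun v y => rfl
  have hker : LinearMap.ker f = ⊥ := by
    refine LinearMap.ker_eq_bot'.2 fun v hv => hφ.eq_zero fun y => ?_
    have h1 := congrFun hv y
    rw [hf] at h1
    rw [← Real.mul_self_sqrt (h0 y), mul_assoc, h1, Pi.zero_apply, mul_zero]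
  obtain ⟨K, hK, hanti⟩ := f.exists_antilipschitzWith hker
  have hbound : ∀ v, ‖v‖ ≤ K * ‖f v‖ := fun v => by
    simpa using hanti.le_mul_dist v 0
  have hsup : ∀ v, ‖f v‖ ^ 2 ≤ occNormSq μ (featMat φ *ᵥ v) := by
    intro v
    have h2 : ‖f v‖ ≤ √(occNormSq μ (featMat φ *ᵥ v)) := by
      refine (pi_norm_le_iff_of_nonneg (Real.sqrt_nonneg _)).2 fun y => ?_
      rw [Real.norm_eq_abs]
      refine Real.abs_le_sqrt ?_
      rw [hf, mul_pow, Real.sq_sqrt (h0 y)]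
      exact Finset.single_le_sum (f := fun y => occ μ y * (featMat φ *ᵥ v) y ^ 2)
        (fun y _ => mul_nonneg (h0 y) (sq_nonneg _)) (Finset.mem_univ y)
    exact (Real.le_sqrt (norm_nonneg _) (occNormSq_nonneg μ hγ0 hγ1 _)).1 h2
  have hdot : ∀ v : Fin κ → ℝ, v ⬝ᵥ v ≤ κ * ‖v‖ ^ 2 := by
    intro v
    have : ∀ i ∈ (Finset.univ : Finset (Fin κ)), v i * v i ≤ ‖v‖ ^ 2 := fun i _ => by
      rw [← sq, ← sq_abs]
      exact pow_le_pow_left₀ (abs_nonneg _) (norm_le_pi_norm v i) 2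
    simpa [dotProduct] using Finset.sum_le_card_nsmul _ _ _ this
  have hD : (0 : ℝ) < (κ + 1) * K ^ 2 := by positivity
  -- Comparing `v ⬝ᵥ v` with the sup norm costs `κ`; `κ + 1` keeps the constant positive when `κ =
  -- 0`.
  refine ⟨((κ + 1) * (K : ℝ) ^ 2)⁻¹, inv_pos.2 hD, fun v => ?_⟩
  rw [inv_mul_le_iff₀ hD]
  calc v ⬝ᵥ v ≤ κ * ‖v‖ ^ 2 := hdot v
    _ ≤ (κ + 1) * (K * ‖f v‖) ^ 2 := by
        refine mul_le_mul (by linarith) (pow_le_pow_left₀ (norm_nonneg _) (hbound v) 2)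
          (sq_nonneg _) (by positivity)
    _ = (κ + 1) * (K : ℝ) ^ 2 * ‖f v‖ ^ 2 := by ring
    _ ≤ _ := mul_le_mul_of_nonneg_left (hsup v) hD.le

theorem isUnit_of_mulVec_eq_zero {n : Type*} [Fintype n] [DecidableEq n] {B : Matrix n n ℝ}
    (h : ∀ v, B *ᵥ v = 0 → v = 0) : IsUnit B := by
  rw [← Matrix.mulVec_injective_iff_isUnit]
  intro v w hvw
  exact sub_eq_zero.1 (h _ (by rw [Matrix.mulVec_sub]; exact sub_eq_zero.2 hvw))

theorem isUnit_gram (hφ : IndependentBasis μ φ) (hγ0 : 0 < γ) (hγ1 : γ < 1) :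
    IsUnit (gram μ φ) := by
  refine isUnit_of_mulVec_eq_zero fun v hv => hφ.eq_zero
    (occ_mul_eq_zero_of_occNormSq_eq_zero μ hγ0 hγ1 ?_)
  have h : v ⬝ᵥ gram μ φ *ᵥ v = 0 := by rw [hv, dotProduct_zero]
  rw [gram_mulVec, dotProduct_occFeat] at h
  rw [← h, occNormSq]
  exact Finset.sum_congr rfl fun y _ => by ring

theorem isUnit_tdA (hφ : IndependentBasis μ φ) (hγ0 : 0 < γ) (hγ1 : γ < 1) :
    IsUnit (tdA μ φ) := by
  refine isUnit_of_mulVec_eq_zero fun v hv => hφ.eq_zero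
    (occ_mul_eq_zero_of_occNormSq_eq_zero μ hγ0 hγ1 ?_)
  have h := dotProduct_tdA_mulVec μ φ v hγ0 hγ1
  rw [hv, dotProduct_zero] at h
  have h1 := occNormSq_nonneg μ hγ0 hγ1 (featMat φ *ᵥ v)
  have h2 : 0 < (1 - γ) / 2 := by linarith
  exact le_antisymm (nonpos_of_mul_nonpos_right h h2) h1

theorem mulVec_eq_iff_eq_inv_mulVec {n : Type*} [Fintype n] [DecidableEq n] {B : Matrix n n ℝ}
    (hB : IsUnit B) (v b : n → ℝ) : B *ᵥ v = b ↔ v = B⁻¹ *ᵥ b := by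
  have hdet := (Matrix.isUnit_iff_isUnit_det B).1 hB
  constructor
  · rintro rfl
    rw [Matrix.mulVec_mulVec, Matrix.nonsing_inv_mul _ hdet, Matrix.one_mulVec]
  · rintro rfl
    rw [Matrix.mulVec_mulVec, Matrix.mul_nonsing_inv _ hdet, Matrix.one_mulVec]

theorem IndependentBasis.featMat_mulVec_inj (hφ : IndependentBasis μ φ) {v w : Fin κ → ℝ}
    (h : ∀ y, occ μ y * (featMat φ *ᵥ (v - w)) y = 0) : v = w :=
  sub_eq_zero.1 (hφ.eq_zero h)

/-- The weighted Pythagorean identity at the weighted least squares solution. -/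
theorem occNormSq_sub_featMat_mulVec {F : M.AugState γ ν → ℝ} {w : Fin κ → ℝ}
    (hw : gram μ φ *ᵥ w = occFeat μ φ F) (v : Fin κ → ℝ) :
    occNormSq μ (F - featMat φ *ᵥ v)
      = occNormSq μ (F - featMat φ *ᵥ w) + occNormSq μ (featMat φ *ᵥ (v - w)) := by
  have h : (v - w) ⬝ᵥ occFeat μ φ (F - featMat φ *ᵥ w) = 0 := by
    rw [occFeat_sub, ← gram_mulVec, hw, sub_self, dotProduct_zero]
  rw [dotProduct_occFeat] at h
  have h2 : occNormSq μ (F - featMat φ *ᵥ v) = occNormSq μ (F - featMat φ *ᵥ w)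
      + occNormSq μ (featMat φ *ᵥ (v - w)) - 2 * ∑ y, occ μ y * (featMat φ *ᵥ (v - w)) y
        * (F - featMat φ *ᵥ w) y := by
    simp only [occNormSq, Finset.mul_sum, ← Finset.sum_add_distrib, ← Finset.sum_sub_distrib,
      Matrix.mulVec_sub, Pi.sub_apply]
    exact Finset.sum_congr rfl fun y _ => by ring
  rw [h2, h, mul_zero, sub_zero]

/-- By Pythagoras, a minimizer differs from the least squares solution by a vector whose feature
combination has norm zero, and independence makes that vector zero. -/
theorem forall_occNormSq_le_iff (hφ : IndependentBasis μ φ) (hγ0 : 0 < γ) (hγ1 : γ < 1)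
    (F : M.AugState γ ν → ℝ) (u : Fin κ → ℝ) :
    (∀ v, occNormSq μ (F - featMat φ *ᵥ u) ≤ occNormSq μ (F - featMat φ *ᵥ v)) ↔
      gram μ φ *ᵥ u = occFeat μ φ F := by
  constructor
  · intro h
    set w := (gram μ φ)⁻¹ *ᵥ occFeat μ φ F with hwdef
    have hw : gram μ φ *ᵥ w = occFeat μ φ F :=
      (mulVec_eq_iff_eq_inv_mulVec (isUnit_gram hφ hγ0 hγ1) _ _).2 rfl
    have h1 := h w
    rw [occNormSq_sub_featMat_mulVec hw u] at h1
    have h2 : occNormSq μ (featMat φ *ᵥ (u - w)) = 0 :=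
      le_antisymm (by linarith) (occNormSq_nonneg μ hγ0 hγ1 _)
    rw [hφ.featMat_mulVec_inj (occ_mul_eq_zero_of_occNormSq_eq_zero μ hγ0 hγ1 h2), hw]
  · intro h v
    rw [occNormSq_sub_featMat_mulVec h v]
    linarith [occNormSq_nonneg μ hγ0 hγ1 (featMat φ *ᵥ (v - u))]

theorem gram_mulVec_eq_iff (α lam : ℝ) (v : Fin κ → ℝ) :
    gram μ φ *ᵥ v = occFeat μ φ (bellman μ α lam (featMat φ *ᵥ v)) ↔
      tdA μ φ *ᵥ v = tdB μ φ α lam := by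
  have h := tdB_sub_tdA_mulVec μ φ α lam v
  constructor <;> intro h1
  · rw [h1, sub_self] at h
    exact (sub_eq_zero.1 h).symm
  · rw [h1, sub_self] at h
    exact (sub_eq_zero.1 h.symm).symm

theorem occNormSq_proj_sub_eq_zero_iff (hφ : IndependentBasis μ φ) (hγ0 : 0 < γ) (hγ1 : γ < 1)
    (F : M.AugState γ ν → ℝ) (v : Fin κ → ℝ) :
    occNormSq μ (proj μ φ F - featMat φ *ᵥ v) = 0 ↔ gram μ φ *ᵥ v = occFeat μ φ F := by
  rw [mulVec_eq_iff_eq_inv_mulVec (isUnit_gram hφ hγ0 hγ1), proj_eq, ← Matrix.mulVec_sub]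
  constructor
  · intro h
    exact (hφ.featMat_mulVec_inj (occ_mul_eq_zero_of_occNormSq_eq_zero μ hγ0 hγ1 h)).symm
  · rintro rfl
    simp [occNormSq]

/-- The equality holds also at states that `occ` does not charge: both sides lie in the span of the
features, and their coefficients are already determined on the support. -/
theorem featMat_mulVec_eq_proj_iff (hφ : IndependentBasis μ φ) (hγ0 : 0 < γ) (hγ1 : γ < 1)
    (F : M.AugState γ ν → ℝ) (v : Fin κ → ℝ) :
    featMat φ *ᵥ v = proj μ φ F ↔ gram μ φ *ᵥ v = occFeat μ φ F := by
  constructor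
  · intro h
    rw [← occNormSq_proj_sub_eq_zero_iff hφ hγ0 hγ1, h]
    simp [occNormSq]
  · intro h
    rw [mulVec_eq_iff_eq_inv_mulVec (isUnit_gram hφ hγ0 hγ1)] at h
    rw [proj_eq, ← h]

/-- A function of seminorm zero is orthogonal to every feature, so independence plays no role. -/
theorem gram_mulVec_eq_of_occNormSq_eq_zero (hγ0 : 0 < γ) (hγ1 : γ < 1)
    {F : M.AugState γ ν → ℝ} {v : Fin κ → ℝ} (h : occNormSq μ (F - featMat φ *ᵥ v) = 0) :
    gram μ φ *ᵥ v = occFeat μ φ F := by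
  rw [gram_mulVec, eq_comm, ← sub_eq_zero, ← occFeat_sub]
  funext i
  refine Finset.sum_eq_zero fun y _ => ?_
  rw [mul_right_comm, occ_mul_eq_zero_of_occNormSq_eq_zero μ hγ0 hγ1 h y, zero_mul]

end LinearAlgebra

/-! ### Convergence of the TD(0) critic -/

section Critic

variable {X A : Type*} [Fintype X] [Fintype A] {M : CMDP X A} {γ ν : ℝ}
  {κ : ℕ}

theorem critic_eq_stochIter (φ : M.AugState γ ν → Fin κ → ℝ) (α lam : ℝ) (ζ : ℕ → ℝ) (v0 : Fin κ → ℝ)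
    (z : ℕ → M.AugState γ ν × A × M.AugState γ ν) (k : ℕ) :
    critic φ α lam ζ v0 z k
      = stochIter (fun v z => tdError φ α lam v z • φ z.1) ζ v0 z k := by
  induction k with
  | zero => rfl
  | succ k ih => simp only [critic, stochIter, ih, smul_smul]

theorem tdError_sub (φ : M.AugState γ ν → Fin κ → ℝ) (α lam : ℝ) (v w : Fin κ → ℝ) (z : M.AugState γ ν × A × M.AugState γ ν) :
    tdError φ α lam v z
      = tdError φ α lam w z + (v - w) ⬝ᵥ (γ • φ z.2.2 - φ z.1) := by
  simp only [tdError, dotProduct_sub, sub_dotProduct, dotProduct_smul, smul_eq_mul]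
  ring

/-- The error is affine in `v`; `(a + b)² ≤ 2a² + 2b²` and Cauchy–Schwarz give the quadratic growth
required for stochastic approximation. -/
theorem tdError_sq_le (φ : M.AugState γ ν → Fin κ → ℝ) (α lam : ℝ) (v w : Fin κ → ℝ)
    (z : M.AugState γ ν × A × M.AugState γ ν) :
    tdError φ α lam v z ^ 2 ≤ (2 * tdError φ α lam w z ^ 2
      + 2 * ((γ • φ z.2.2 - φ z.1) ⬝ᵥ (γ • φ z.2.2 - φ z.1)))
        * ((v - w) ⬝ᵥ (v - w) + 1) := by
  rw [tdError_sub φ α lam v w z]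
  set δ := tdError φ α lam w z
  set ψ := γ • φ z.2.2 - φ z.1
  set u := v - w
  have hcs : (u ⬝ᵥ ψ) ^ 2 ≤ (u ⬝ᵥ u) * (ψ ⬝ᵥ ψ) := by
    simpa only [dotProduct, sq] using Finset.sum_mul_sq_le_sq_mul_sq Finset.univ u ψ
  have hu : 0 ≤ u ⬝ᵥ u := Finset.sum_nonneg fun i _ => mul_self_nonneg _
  have hψ : 0 ≤ ψ ⬝ᵥ ψ := Finset.sum_nonneg fun i _ => mul_self_nonneg _
  nlinarith [sq_nonneg (δ - u ⬝ᵥ ψ), mul_nonneg hu (sq_nonneg δ)]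

variable [Fintype (M.AugState γ ν)] (μ : Policy M γ ν) (φ : M.AugState γ ν → Fin κ → ℝ)

/-- The expected temporal-difference update. -/
theorem sum_tdError_mul (α lam : ℝ) (v : Fin κ → ℝ) (i : Fin κ) :
    ∑ z : M.AugState γ ν × A × M.AugState γ ν,
      (occSA μ z.1 z.2.1 * M.augP z.1 z.2.1 z.2.2) * (tdError φ α lam v z * φ z.1 i)
      = (tdB μ φ α lam - tdA μ φ *ᵥ v) i := by
  rw [tdB_sub_tdA_mulVec, gram_mulVec, ← occFeat_sub]
  simp only [occFeat, Fintype.sum_prod_type]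
  refine Finset.sum_congr rfl fun y _ => ?_
  have h : ∀ a, ∑ y', occSA μ y a * M.augP y a y' * (tdError φ α lam v (y, a, y') * φ y i)
      = occ μ y * φ y i * (μ.prob y a * (M.augCost α lam y a
        + ∑ y', γ * M.augP y a y' * (featMat φ *ᵥ v) y') - μ.prob y a * (featMat φ *ᵥ v) y) := by
    intro a
    have h1 : ∑ y', occSA μ y a * M.augP y a y' * (tdError φ α lam v (y, a, y') * φ y i)
        = occ μ y * φ y i * μ.prob y a * ∑ y', (M.augP y a y' * (M.augCost α lam y a
          - (featMat φ *ᵥ v) y) + γ * M.augP y a y' * (featMat φ *ᵥ v) y') := by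
      rw [Finset.mul_sum]
      refine Finset.sum_congr rfl fun y' _ => ?_
      simp only [occSA, tdError, featMat_mulVec_apply, dotProduct_comm v]
      ring
    rw [h1, Finset.sum_add_distrib, ← Finset.sum_mul, augP_sum]
    ring
  rw [Finset.sum_congr rfl fun a _ => h a, ← Finset.mul_sum, Finset.sum_sub_distrib,
    ← Finset.sum_mul, μ.sum_eq_one, one_mul]
  rfl

theorem sum_dotProduct_tdError (α lam : ℝ) (u v : Fin κ → ℝ) :
    ∑ z : M.AugState γ ν × A × M.AugState γ ν,
      (occSA μ z.1 z.2.1 * M.augP z.1 z.2.1 z.2.2) * (u ⬝ᵥ tdError φ α lam v z • φ z.1)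
      = u ⬝ᵥ (tdB μ φ α lam - tdA μ φ *ᵥ v) := by
  simp_rw [dotProduct, ← sum_tdError_mul, Pi.smul_apply, smul_eq_mul, Finset.mul_sum]
  rw [Finset.sum_comm]
  exact Finset.sum_congr rfl fun i _ => Finset.sum_congr rfl fun z _ => by ring

theorem ae_tendsto_critic {μ : Policy M γ ν} {φ : M.AugState γ ν → Fin κ → ℝ}
    (hφ : IndependentBasis μ φ) (hγ0 : 0 < γ) (hγ1 : γ < 1) {α lam : ℝ}
    {ζ : ℕ → ℝ} (hζ0 : ∀ k, 0 ≤ ζ k)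
    (hζ1 : Tendsto (fun n => ∑ k ∈ Finset.range n, ζ k) atTop atTop)
    (hζ2 : Summable (fun k => ζ k ^ 2))
    {Ω : Type*} [MeasurableSpace Ω] {Pr : Measure Ω} [IsProbabilityMeasure Pr]
    {Z : ℕ → Ω → M.AugState γ ν × A × M.AugState γ ν} (hZ : IsOccSampling μ Pr Z)
    {vstar : Fin κ → ℝ} (hv : tdA μ φ *ᵥ vstar = tdB μ φ α lam) (v0 : Fin κ → ℝ) :
    ∀ᵐ ω ∂Pr, Tendsto (fun k => critic φ α lam ζ v0 (fun j => Z j ω) k) atTop (𝓝 vstar) := by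
  obtain ⟨c, hc, hcle⟩ := hφ.exists_pos_le_occNormSq hγ0 hγ1
  have hp0 : ∀ z : M.AugState γ ν × A × M.AugState γ ν,
      0 ≤ occSA μ z.1 z.2.1 * M.augP z.1 z.2.1 z.2.2 := fun z =>
    mul_nonneg (mul_nonneg (occ_nonneg μ hγ0 hγ1 _) (μ.nonneg _ _)) (augP_nonneg _ _ _)
  have hdot0 : ∀ w : Fin κ → ℝ, 0 ≤ w ⬝ᵥ w := fun w =>
    Finset.sum_nonneg fun i _ => mul_self_nonneg _
  simp_rw [critic_eq_stochIter]
  refine ae_tendsto_stochIter hZ.meas hZ.indep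
    (p := fun z => occSA μ z.1 z.2.1 * M.augP z.1 z.2.1 z.2.2)
    (fun k z => hZ.law k z.1 z.2.1 z.2.2) (fun z => ?_) hζ0 hζ1 hζ2
    -- The drift rate combines coercivity of `A` with the lower bound on `‖Φ v‖_d²`; `K` is the mean
    -- of the factor in `tdError_sq_le` times `φ ⬝ᵥ φ`.
    (c := (1 - γ) / 2 * c) (mul_pos (by linarith) hc)
    (K := ∑ z : M.AugState γ ν × A × M.AugState γ ν,
      (occSA μ z.1 z.2.1 * M.augP z.1 z.2.1 z.2.2) * ((2 * tdError φ α lam vstar z ^ 2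
      + 2 * ((γ • φ z.2.2 - φ z.1) ⬝ᵥ (γ • φ z.2.2 - φ z.1))) * (φ z.1 ⬝ᵥ φ z.1)))
    ?_ (fun v => ?_) (fun v => ?_) v0
  · simp only [tdError, dotProduct]
    fun_prop
  · exact Finset.sum_nonneg fun z _ => mul_nonneg (hp0 z) (mul_nonneg
      (add_nonneg (by positivity) (mul_nonneg zero_le_two (hdot0 _))) (hdot0 _))
  -- With `b = A vstar`, the mean update is `-A (v - vstar)`.
  · rw [sum_dotProduct_tdError, ← hv, ← Matrix.mulVec_sub, ← neg_sub v vstar,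
      Matrix.mulVec_neg, dotProduct_neg, neg_mul, neg_le_neg_iff, mul_assoc]
    exact (mul_le_mul_of_nonneg_left (hcle _) (by linarith)).trans
      (dotProduct_tdA_mulVec μ φ _ hγ0 hγ1)
  · rw [Finset.sum_mul]
    refine Finset.sum_le_sum fun z _ => ?_
    refine (mul_le_mul_of_nonneg_left ?_ (hp0 z)).trans_eq (mul_assoc _ _ _).symm
    rw [smul_dotProduct, dotProduct_smul, smul_eq_mul, smul_eq_mul, ← mul_assoc, ← sq]
    refine (mul_le_mul_of_nonneg_right (tdError_sq_le φ α lam v vstar z) (hdot0 _)).trans_eq ?_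
    ring

end Critic

end CMDP

/-! ### The main theorem -/

theorem theorem2 {X A : Type*} [Fintype X] [Fintype A] (M : CMDP X A)
    (γ ν α lam : ℝ) (hγ0 : 0 < γ) (hγ1 : γ < 1) (hα0 : 0 < α) (hα1 : α < 1) (hlam : 0 ≤ lam)
    [Fintype (M.AugState γ ν)] (μ : CMDP.Policy M γ ν)
    {κ : ℕ} (φ : M.AugState γ ν → Fin κ → ℝ) (hφ : CMDP.IndependentBasis μ φ)
    (ζ : ℕ → ℝ) (hζ0 : ∀ k, 0 ≤ ζ k)
    (hζ1 : Tendsto (fun n => ∑ k ∈ Finset.range n, ζ k) atTop atTop)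
    (hζ2 : Summable (fun k => ζ k ^ 2))
    {Ω : Type*} [MeasurableSpace Ω] (Pr : Measure Ω) [IsProbabilityMeasure Pr]
    (Z : ℕ → Ω → M.AugState γ ν × A × M.AugState γ ν) (hZ : CMDP.IsOccSampling μ Pr Z) :
    ∃ vstar : Fin κ → ℝ,
      -- `vstar` is the unique solution of `A v = b`
      (∀ v, CMDP.tdA μ φ *ᵥ v = CMDP.tdB μ φ α lam ↔ v = vstar) ∧
      -- `Φ vstar` is the unique projected Bellman fixed point in the span of the features
      (∀ v, CMDP.featMat φ *ᵥ v
          = CMDP.proj μ φ (CMDP.bellman μ α lam (CMDP.featMat φ *ᵥ v)) ↔ v = vstar) ∧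
      -- `vstar` is the unique minimizer of the projected Bellman residual
      (∀ u, (∀ v, CMDP.occNormSq μ (CMDP.proj μ φ (CMDP.bellman μ α lam (CMDP.featMat φ *ᵥ u))
              - CMDP.featMat φ *ᵥ u)
            ≤ CMDP.occNormSq μ (CMDP.proj μ φ (CMDP.bellman μ α lam (CMDP.featMat φ *ᵥ v))
              - CMDP.featMat φ *ᵥ v)) ↔ u = vstar) ∧
      -- `vstar` is the unique `u` minimizing `v ↦ ‖B[Φ u] - Φ v‖²` at `v = u`
      (∀ u, (∀ v, CMDP.occNormSq μ
              (CMDP.bellman μ α lam (CMDP.featMat φ *ᵥ u) - CMDP.featMat φ *ᵥ u)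
            ≤ CMDP.occNormSq μ
              (CMDP.bellman μ α lam (CMDP.featMat φ *ᵥ u) - CMDP.featMat φ *ᵥ v)) ↔ u = vstar) ∧
      -- if the Bellman residual can be made zero, then `vstar` is its unique minimizer
      ((∃ u, CMDP.occNormSq μ
            (CMDP.bellman μ α lam (CMDP.featMat φ *ᵥ u) - CMDP.featMat φ *ᵥ u) = 0) →
        ∀ u, (∀ v, CMDP.occNormSq μ
              (CMDP.bellman μ α lam (CMDP.featMat φ *ᵥ u) - CMDP.featMat φ *ᵥ u)
            ≤ CMDP.occNormSq μ
              (CMDP.bellman μ α lam (CMDP.featMat φ *ᵥ v) - CMDP.featMat φ *ᵥ v)) ↔ u = vstar) ∧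
      -- almost sure convergence of the critic from every initial weight vector
      (∀ v0 : Fin κ → ℝ, ∀ᵐ ω ∂Pr,
        Tendsto (fun k => CMDP.critic φ α lam ζ v0 (fun j => Z j ω) k) atTop (𝓝 vstar)) := by
  -- A nonnegative function with exactly one zero has that zero as its unique minimizer; this
  -- settles both residual claims.
  have hmin0 : ∀ {f : (Fin κ → ℝ) → ℝ} {w : Fin κ → ℝ}, (∀ v, 0 ≤ f v) →
      (∀ v, f v = 0 ↔ v = w) → ∀ u, (∀ v, f u ≤ f v) ↔ u = w := by
    intro f w h0 hf u
    refine ⟨fun h => (hf u).1 (le_antisymm ((h w).trans_eq ((hf w).2 rfl)) (h0 u)), ?_⟩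
    intro h v
    rw [(hf u).2 h]
    exact h0 v
  have hnn := CMDP.occNormSq_nonneg μ hγ0 hγ1
  have hA := CMDP.mulVec_eq_iff_eq_inv_mulVec (CMDP.isUnit_tdA hφ hγ0 hγ1)
  have hG : ∀ v, CMDP.gram μ φ *ᵥ v
      = CMDP.occFeat μ φ (CMDP.bellman μ α lam (CMDP.featMat φ *ᵥ v)) ↔
      v = (CMDP.tdA μ φ)⁻¹ *ᵥ CMDP.tdB μ φ α lam := fun v =>
    (CMDP.gram_mulVec_eq_iff α lam v).trans (hA v _)
  refine ⟨(CMDP.tdA μ φ)⁻¹ *ᵥ CMDP.tdB μ φ α lam, fun v => hA v _, fun v => ?_, ?_, fun u => ?_,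
    ?_, fun v0 => ?_⟩
  · rw [CMDP.featMat_mulVec_eq_proj_iff hφ hγ0 hγ1, hG]
  · refine hmin0 (fun v => hnn _) fun v => ?_
    rw [CMDP.occNormSq_proj_sub_eq_zero_iff hφ hγ0 hγ1, hG]
  · rw [CMDP.forall_occNormSq_le_iff hφ hγ0 hγ1, hG]
  · rintro ⟨w, hw⟩
    -- Any zero of the Bellman residual solves the normal equations, so the assumed zero `w` is the
    -- only one.
    have hz : ∀ v, CMDP.occNormSq μ (CMDP.bellman μ α lam (CMDP.featMat φ *ᵥ v)
        - CMDP.featMat φ *ᵥ v) = 0 → v = (CMDP.tdA μ φ)⁻¹ *ᵥ CMDP.tdB μ φ α lam := fun v h =>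
      (hG v).1 (CMDP.gram_mulVec_eq_of_occNormSq_eq_zero hγ0 hγ1 h)
    refine hmin0 (fun v => hnn _) fun v => ⟨hz v, ?_⟩
    rintro rfl
    rwa [← hz w hw]
  · exact CMDP.ae_tendsto_critic hφ hγ0 hγ1 hζ0 hζ1 hζ2 hZ ((hA _ _).2 rfl) v0
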